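/- For real $\epsilon,\epsilon'$, $\zeta\in\mathbb{C}$ and $\tau$ in the upper half plane $\{\operatorname{Im}\tau>0\}$ let $$\theta\!\left[\begin{matrix}\epsilon\\ \epsilon'\end{matrix}\right](\zeta,\tau)=\sum_{n\in\mathbb{Z}}\exp\left(2\pi i\left[\tfrac12\left(n+\tfrac{\epsilon}{2}\right)^2\tau+\left(n+\tfrac{\epsilon}{2}\right)\left(\zeta+\tfrac{\epsilon'}{2}\right)\right]\right),$$ and write $\theta[\epsilon;\epsilon']$, $\theta'[\epsilon;\epsilon']$, $\theta''[\epsilon;\epsilon']$ for the value and the first and second derivatives with respect to $\zeta$ of this function at $\zeta=0$, which are functions of $\tau$. Then for every $\tau$ with $\operatorname{Im}\tau>0$ the theta constants $\theta[1;\tfrac14]$ and $\theta[1;\tfrac34]$ are nonzero, and $$\frac{\theta''[1;\frac14]}{\theta[1;\frac14]}-\frac{\theta''[1;\frac34]}{\theta[1;\frac34]}=-\frac18\,\frac{\left(\theta'[1;1]\right)^2\,\theta[1;0]\,\theta[1;\frac12]}{\theta^4[1;\frac14]\,\theta^4[1;\frac34]}\left(\theta^4[1;\tfrac14]-6\,\theta^2[1;\tfrac14]\,\theta^2[1;\tfrac34]+\theta^4[1;\tfrac34]\right).$$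 -/

import Mathlib

noncomputable section

namespace ThetaChar

/-- The `n`-th term of the series of the theta function with characteristics `[ε; ε']`. -/
def term (ε ε' : ℝ) (ζ τ : ℂ) (n : ℤ) : ℂ :=
  Complex.exp (2 * (Real.pi : ℂ) * Complex.I *
    ((1 / 2 : ℂ) * ((n : ℂ) + (ε : ℂ) / 2) ^ 2 * τ
      + ((n : ℂ) + (ε : ℂ) / 2) * (ζ + (ε' : ℂ) / 2)))

/-- The theta function with characteristics `θ[ε; ε'](ζ, τ)`. -/
def theta (ε ε' : ℝ) (ζ τ : ℂ) : ℂ := ∑' n : ℤ, term ε ε' ζ τ n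

/-- The theta constant `θ[ε; ε'] = θ[ε; ε'](0, τ)`. -/
def thetaConst (ε ε' : ℝ) (τ : ℂ) : ℂ := theta ε ε' 0 τ

/-- `θ'[ε; ε']`, the derivative in `ζ` at `ζ = 0`. -/
def thetaConst' (ε ε' : ℝ) (τ : ℂ) : ℂ := deriv (fun ζ : ℂ => theta ε ε' ζ τ) 0

/-- `θ''[ε; ε']`, the second derivative in `ζ` at `ζ = 0`. -/
def thetaConst'' (ε ε' : ℝ) (τ : ℂ) : ℂ := iteratedDeriv 2 (fun ζ : ℂ => theta ε ε' ζ τ) 0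

theorem term_eq (ε ε' : ℝ) (ζ τ : ℂ) (n : ℤ) :
    term ε ε' ζ τ n =
      Complex.exp (2 * (Real.pi : ℂ) * Complex.I *
        ((1 / 2 : ℂ) * ((ε : ℂ) / 2) ^ 2 * τ + (ε : ℂ) / 2 * (ζ + (ε' : ℂ) / 2))) *
      jacobiTheta₂_term n (ζ + (ε' : ℂ) / 2 + (ε : ℂ) / 2 * τ) τ := by
  unfold term jacobiTheta₂_term
  rw [← Complex.exp_add]
  congr 1
  ring

/-- The defining series converges (absolutely) on the upper half plane. -/
theorem summable_term (ε ε' : ℝ) (ζ : ℂ) {τ : ℂ} (hτ : 0 < τ.im) :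
    Summable (term ε ε' ζ τ) := by
  have h := ((summable_jacobiTheta₂_term_iff
    (ζ + (ε' : ℂ) / 2 + (ε : ℂ) / 2 * τ) τ).2 hτ).mul_left
      (Complex.exp (2 * (Real.pi : ℂ) * Complex.I *
        ((1 / 2 : ℂ) * ((ε : ℂ) / 2) ^ 2 * τ + (ε : ℂ) / 2 * (ζ + (ε' : ℂ) / 2))))
  exact h.congr fun n => (term_eq ε ε' ζ τ n).symm

/-- `θ[ε; ε'](·, τ)` is entire, so that the derivatives above are genuine derivatives. -/
theorem differentiable_theta (ε ε' : ℝ) {τ : ℂ} (hτ : 0 < τ.im) :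
    Differentiable ℂ (fun ζ : ℂ => theta ε ε' ζ τ) := by
  have h : (fun ζ : ℂ => theta ε ε' ζ τ) = fun ζ : ℂ =>
      Complex.exp (2 * (Real.pi : ℂ) * Complex.I *
        ((1 / 2 : ℂ) * ((ε : ℂ) / 2) ^ 2 * τ + (ε : ℂ) / 2 * (ζ + (ε' : ℂ) / 2))) *
      jacobiTheta₂ (ζ + (ε' : ℂ) / 2 + (ε : ℂ) / 2 * τ) τ := by
    funext ζ
    unfold theta jacobiTheta₂
    rw [← tsum_mul_left]
    exact tsum_congr fun n => term_eq ε ε' ζ τ n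
  rw [h]
  intro ζ
  have hj : DifferentiableAt ℂ
      (fun ζ : ℂ => jacobiTheta₂ (ζ + (ε' : ℂ) / 2 + (ε : ℂ) / 2 * τ) τ) ζ :=
    DifferentiableAt.comp ζ (g := fun z : ℂ => jacobiTheta₂ z τ)
      (f := fun ζ : ℂ => ζ + (ε' : ℂ) / 2 + (ε : ℂ) / 2 * τ)
      (differentiableAt_jacobiTheta₂_fst _ hτ) (by fun_prop)
  exact DifferentiableAt.mul (by fun_prop) hj

end ThetaChar

end

namespace ThetaChar

open Complex Filter Topology

/-! Write σ for the odd theta function `oddTheta τ`. The constants in play are a = σ(3/8), b =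
σ(1/8), s = σ(1/4), t = σ(1/2) and p = σ'(0), up to sign. The product formula
`theta_add_mul_theta_sub` yields Weierstrass's three-term relation for σ. Its second derivative
expresses (log σ)''(3/8) - (log σ)''(1/8) as p²ts/(a²b²). Specialised first derivatives give two
linear equations for σ'(3/8) and σ'(1/8), and specialised values give two relations among a, b, s,
t. Eliminating the first derivatives (`div_sub_div_eq_of_relations`) leaves the identity.
Non-vanishing of a and b comes from duplication formulas, modular inversion and the limit Im τ → ∞.
-/

theorem hasSum_term (ε ε' : ℝ) (ζ : ℂ) {τ : ℂ} (hτ : 0 < τ.im) :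
    HasSum (term ε ε' ζ τ) (theta ε ε' ζ τ) :=
  (summable_term ε ε' ζ hτ).hasSum

/-! ### Product formula -/

/-- Reindexing a double sum over `ℤ × ℤ` by the sum and difference of the indices. -/
theorem hasSum_int_prod_of_parity {F : ℤ × ℤ → ℂ} {a b : ℂ}
    (he : HasSum (fun p : ℤ × ℤ => F (p.1 + p.2, p.1 - p.2)) a)
    (ho : HasSum (fun p : ℤ × ℤ => F (p.1 + p.2, p.1 - p.2 - 1)) b) : HasSum F (a + b) := by
  have ie : Function.Injective (fun p : ℤ × ℤ => (p.1 + p.2, p.1 - p.2)) := by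
    rintro ⟨a, b⟩ ⟨c, d⟩ h
    simp only [Prod.mk.injEq] at h ⊢
    omega
  have io : Function.Injective (fun p : ℤ × ℤ => (p.1 + p.2, p.1 - p.2 - 1)) := by
    rintro ⟨a, b⟩ ⟨c, d⟩ h
    simp only [Prod.mk.injEq] at h ⊢
    omega
  refine HasSum.add_isCompl (s := Set.range fun p : ℤ × ℤ => (p.1 + p.2, p.1 - p.2))
    (t := Set.range fun p : ℤ × ℤ => (p.1 + p.2, p.1 - p.2 - 1)) ?_
    (ie.hasSum_range_iff.2 he) (io.hasSum_range_iff.2 ho)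
  refine isCompl_iff.2 ⟨?_, ?_⟩
  · rw [Set.disjoint_left]
    rintro _ ⟨⟨a, b⟩, rfl⟩ ⟨⟨c, d⟩, h⟩
    simp only [Prod.mk.injEq] at h
    omega
  · refine codisjoint_iff.2 (Set.eq_univ_of_forall fun ⟨m, n⟩ => ?_)
    rcases Int.even_or_odd (m + n) with ⟨k, hk⟩ | ⟨k, hk⟩
    · exact Or.inl ⟨(k, m - k), by simp only [Prod.mk.injEq]; omega⟩
    · exact Or.inr ⟨(k + 1, m - k - 1), by simp only [Prod.mk.injEq]; omega⟩

theorem im_two_mul_pos {τ : ℂ} (hτ : 0 < τ.im) : 0 < (2 * τ).im := by simpa using hτ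

/-- The product of two theta functions as a combination of theta functions at `2 * τ`. -/
theorem theta_add_mul_theta_sub (ε : ℝ) (x y : ℂ) {τ : ℂ} (hτ : 0 < τ.im) :
    theta ε 0 (x + y) τ * theta ε 0 (x - y) τ =
      theta ε 0 (2 * x) (2 * τ) * theta 0 0 (2 * y) (2 * τ) +
        theta (ε - 1) 0 (2 * x) (2 * τ) * theta 1 0 (2 * y) (2 * τ) := by
  have hn (δ : ℝ) (z : ℂ) {σ : ℂ} (hσ : 0 < σ.im) := (summable_term δ 0 z hσ).norm
  have h2 := im_two_mul_pos hτ
  have hprod (δ δ' : ℝ) (z w : ℂ) {σ : ℂ} (hσ : 0 < σ.im) :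
      HasSum (fun p : ℤ × ℤ => term δ 0 z σ p.1 * term δ' 0 w σ p.2)
        (theta δ 0 z σ * theta δ' 0 w σ) :=
    (hasSum_term δ 0 z hσ).mul (hasSum_term δ' 0 w hσ)
      (summable_mul_of_summable_norm (hn δ z hσ) (hn δ' w hσ))
  refine (hprod ε ε (x + y) (x - y) hτ).unique (hasSum_int_prod_of_parity ?_ ?_)
  · refine (hprod ε 0 (2 * x) (2 * y) h2).congr_fun fun p => ?_
    simp only [term, ← Complex.exp_add]
    congr 1
    push_cast
    ring
  -- The shift by -1 turns the half-sum of the two indices into p.1 + (ε - 1)/2 and the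
  -- half-difference into p.2 + 1/2; for ε = 1 the first characteristic is then exactly 0.
  · refine (hprod (ε - 1) 1 (2 * x) (2 * y) h2).congr_fun fun p => ?_
    simp only [term, ← Complex.exp_add]
    congr 1
    push_cast
    ring

/-! ### Symmetries in ζ -/

theorem theta_char_right (ε ε' : ℝ) (ζ τ : ℂ) :
    theta ε ε' ζ τ = theta ε 0 (ζ + ε' / 2) τ := by
  refine tsum_congr fun n => ?_
  simp [term]

theorem theta_one_neg (ζ τ : ℂ) : theta 1 0 (-ζ) τ = theta 1 0 ζ τ := by
  unfold theta
  rw [← (Equiv.subLeft (-1 : ℤ)).tsum_eq]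
  refine tsum_congr fun n => ?_
  simp only [term, Equiv.subLeft_apply]
  congr 1
  push_cast
  ring

theorem theta_add_one (ε : ℝ) (ζ τ : ℂ) :
    theta ε 0 (ζ + 1) τ = cexp (Real.pi * I * ε) * theta ε 0 ζ τ := by
  unfold theta
  rw [← tsum_mul_left]
  refine tsum_congr fun n => ?_
  have h : term ε 0 (ζ + 1) τ n = cexp (Real.pi * I * ε) * term ε 0 ζ τ n *
      cexp (n * (2 * Real.pi * I)) := by
    simp only [term, ← Complex.exp_add]
    congr 1
    push_cast
    ring
  rw [h, Complex.exp_int_mul_two_pi_mul_I, mul_one]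

theorem theta_one_add_one (ζ τ : ℂ) : theta 1 0 (ζ + 1) τ = -theta 1 0 ζ τ := by
  simp [theta_add_one]

theorem theta_zero_add_one (ζ τ : ℂ) : theta 0 0 (ζ + 1) τ = theta 0 0 ζ τ := by
  simp [theta_add_one]

/-! ### Non-vanishing -/

theorem theta_one_half (τ : ℂ) : theta 1 0 (1 / 2) τ = 0 := by
  have h := theta_one_add_one (-(1 / 2)) τ
  rw [theta_one_neg, show -(1 / 2 : ℂ) + 1 = 1 / 2 by norm_num] at h
  linear_combination h / 2

theorem theta_zero_eq (ζ τ : ℂ) : theta 0 0 ζ τ = jacobiTheta₂ ζ τ :=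
  tsum_congr fun n => by simp [term_eq]

theorem theta_one_eq (τ : ℂ) :
    theta 1 0 0 τ = cexp (Real.pi * I * τ / 4) * jacobiTheta₂ (τ / 2) τ := by
  unfold theta jacobiTheta₂
  rw [← tsum_mul_left]
  refine tsum_congr fun n => ?_
  rw [term_eq]
  push_cast
  congr 2 <;> ring

theorem jacobiTheta₂_half (τ : ℂ) : jacobiTheta₂ (1 / 2) τ = jacobiTheta (τ + 1) := by
  refine tsum_congr fun n => ?_
  obtain ⟨k, hk⟩ := Int.even_mul_pred_self n
  have hk' : (n : ℂ) * (n - 1) = k + k := by exact_mod_cast congrArg (Int.cast : ℤ → ℂ) hk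
  have h : cexp (Real.pi * I * (n : ℂ) ^ 2 * (τ + 1)) =
      jacobiTheta₂_term n (1 / 2) τ * cexp (k * (2 * Real.pi * I)) := by
    rw [jacobiTheta₂_term, ← Complex.exp_add]
    congr 1
    linear_combination (Real.pi : ℂ) * I * hk'
  rw [h, Complex.exp_int_mul_two_pi_mul_I, mul_one]

theorem theta_zero_mul_theta_half {τ : ℂ} (hτ : 0 < τ.im) :
    theta 0 0 (1 / 2) τ * theta 0 0 0 τ = theta 0 0 (1 / 2) (2 * τ) ^ 2 := by
  have h := theta_add_mul_theta_sub 0 (1 / 4) (1 / 4) hτ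
  norm_num at h
  have h' := theta_one_half (2 * τ)
  norm_num at h' ⊢
  rw [h, h']
  ring

/-- By duplication a zero at τ propagates to every 2 ^ k * τ, whereas the value tends to 1 as the
imaginary part grows. -/
theorem theta_zero_half_ne_zero {τ : ℂ} (hτ : 0 < τ.im) : theta 0 0 (1 / 2) τ ≠ 0 := by
  intro h0
  have hp : ∀ k : ℕ, 0 < ((2 : ℂ) ^ k * τ).im ∧ theta 0 0 (1 / 2) ((2 : ℂ) ^ k * τ) = 0 := by
    intro k
    induction k with
    | zero => simpa using ⟨hτ, by simpa using h0⟩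
    | succ k ih =>
      have h := theta_zero_mul_theta_half ih.1
      rw [ih.2, zero_mul, ← mul_assoc, ← pow_succ'] at h
      refine ⟨?_, pow_eq_zero_iff two_ne_zero |>.1 h.symm⟩
      rw [pow_succ', mul_assoc]
      exact im_two_mul_pos ih.1
  have him (k : ℕ) : ((2 : ℂ) ^ k * τ).im = 2 ^ k * τ.im := by
    rw [show (2 : ℂ) ^ k = ((2 ^ k : ℝ) : ℂ) by push_cast; rfl, im_ofReal_mul]
  have hlim : Tendsto (fun k : ℕ => Real.exp (-Real.pi * (2 ^ k * τ.im))) atTop (𝓝 0) := by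
    refine Real.tendsto_exp_atBot.comp (Tendsto.const_mul_atTop_of_neg
      (neg_lt_zero.2 Real.pi_pos) (Tendsto.atTop_mul_const hτ ?_))
    exact tendsto_pow_atTop_atTop_of_one_lt one_lt_two
  -- With q this exponential, the distance of the theta value from 1 is at most 2q/(1 - q), which is
  -- below 1 once q < 1/3.
  obtain ⟨k, hk⟩ := (hlim.eventually (gt_mem_nhds (show (0 : ℝ) < 1 / 4 by norm_num))).exists
  have hb := norm_jacobiTheta_sub_one_le (τ := 2 ^ k * τ + 1) (by simpa using (hp k).1)
  rw [← jacobiTheta₂_half, ← theta_zero_eq, (hp k).2, add_im, one_im, add_zero, him, zero_sub,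
    norm_neg, norm_one, div_mul_eq_mul_div, le_div_iff₀ (by linarith)] at hb
  linarith

/-- The inversion τ ↦ -1/τ carries this constant to the one of `theta_zero_half_ne_zero`. -/
theorem theta_one_zero_ne_zero {τ : ℂ} (hτ : 0 < τ.im) : theta 1 0 0 τ ≠ 0 := by
  have h0 : τ ≠ 0 := by rintro rfl; simp at hτ
  have h1 : 0 < (-1 / τ).im := by
    rw [neg_div, neg_im, one_div, inv_im, neg_div, neg_neg]
    exact div_pos hτ (normSq_pos.2 h0)
  rw [theta_one_eq, jacobiTheta₂_functional_equation, show τ / 2 / τ = 1 / 2 by field_simp,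
    ← theta_zero_eq]
  refine mul_ne_zero (Complex.exp_ne_zero _) (mul_ne_zero (mul_ne_zero (one_div_ne_zero ?_)
    (Complex.exp_ne_zero _)) (theta_zero_half_ne_zero h1))
  simp [cpow_eq_zero_iff, h0]

theorem theta_one_quarter_ne_zero {τ : ℂ} (hτ : 0 < τ.im) : theta 1 0 (1 / 4) τ ≠ 0 := by
  have h := theta_add_mul_theta_sub 1 0 (1 / 4) hτ
  have h2 := im_two_mul_pos hτ
  rw [zero_add, zero_sub, theta_one_neg, mul_zero, show (2 : ℂ) * (1 / 4) = 1 / 2 by norm_num,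
    theta_one_half, mul_zero, add_zero] at h
  exact left_ne_zero_of_mul
    (h ▸ mul_ne_zero (theta_one_zero_ne_zero h2) (theta_zero_half_ne_zero h2))

theorem theta_one_eighth_mul_ne_zero {τ : ℂ} (hτ : 0 < τ.im) :
    theta 1 0 (3 / 8) τ * theta 1 0 (1 / 8) τ ≠ 0 := by
  have h := theta_add_mul_theta_sub 1 (1 / 4) (1 / 8) hτ
  have h2 := im_two_mul_pos hτ
  rw [show (1 / 4 + 1 / 8 : ℂ) = 3 / 8 by norm_num, show (1 / 4 - 1 / 8 : ℂ) = 1 / 8 by norm_num,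
    show (2 : ℂ) * (1 / 4) = 1 / 2 by norm_num, show (2 : ℂ) * (1 / 8) = 1 / 4 by norm_num,
    theta_one_half, zero_mul, zero_add, sub_self] at h
  exact h ▸ mul_ne_zero (theta_zero_half_ne_zero h2) (theta_one_quarter_ne_zero h2)

/-! ### Three-term relation and its derivatives -/

/-- The odd theta function `θ[1; -1]`. -/
noncomputable def oddTheta (τ z : ℂ) : ℂ := theta 1 0 (z - 1 / 2) τ

theorem oddTheta_neg (τ z : ℂ) : oddTheta τ (-z) = -oddTheta τ z := by
  unfold oddTheta
  rw [← theta_one_add_one, ← theta_one_neg]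
  congr 1
  ring

theorem oddTheta_one_sub (τ z : ℂ) : oddTheta τ (1 - z) = oddTheta τ z := by
  unfold oddTheta
  rw [← theta_one_neg]
  congr 1
  ring

theorem theta_one_eq_oddTheta (z τ : ℂ) : theta 1 0 z τ = oddTheta τ (1 / 2 - z) := by
  unfold oddTheta
  rw [← theta_one_neg]
  congr 1
  ring

theorem oddTheta_add_mul_oddTheta_sub (x y : ℂ) {τ : ℂ} (hτ : 0 < τ.im) :
    oddTheta τ (x + y) * oddTheta τ (x - y) =
      theta 0 0 (2 * x) (2 * τ) * theta 1 0 (2 * y) (2 * τ) -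
        theta 1 0 (2 * x) (2 * τ) * theta 0 0 (2 * y) (2 * τ) := by
  have h := theta_add_mul_theta_sub 1 (x - 1 / 2) y hτ
  have h1 := theta_one_add_one (2 * (x - 1 / 2)) (2 * τ)
  have h0 := theta_zero_add_one (2 * (x - 1 / 2)) (2 * τ)
  rw [show 2 * (x - 1 / 2) + 1 = 2 * x by ring] at h0 h1
  rw [sub_self] at h
  rw [oddTheta, oddTheta, h0, h1, show x + y - 1 / 2 = x - 1 / 2 + y by ring,
    show x - y - 1 / 2 = x - 1 / 2 - y by ring, h]
  ring

/-- Weierstrass's three-term relation. -/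
theorem oddTheta_three_term (x y z w : ℂ) {τ : ℂ} (hτ : 0 < τ.im) :
    oddTheta τ (x + y) * oddTheta τ (x - y) * (oddTheta τ (z + w) * oddTheta τ (z - w)) +
      oddTheta τ (y + z) * oddTheta τ (y - z) * (oddTheta τ (x + w) * oddTheta τ (x - w)) +
      oddTheta τ (z + x) * oddTheta τ (z - x) * (oddTheta τ (y + w) * oddTheta τ (y - w)) = 0 := by
  -- Each paired product becomes a 2 × 2 minor f(x)g(y) - g(x)f(y), so this is the Plücker relation.
  simp only [oddTheta_add_mul_oddTheta_sub _ _ hτ]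
  ring

theorem oddTheta_zero (τ : ℂ) : oddTheta τ 0 = 0 := by
  have h := oddTheta_neg τ 0
  rw [neg_zero] at h
  linear_combination h / 2

theorem differentiable_oddTheta {τ : ℂ} (hτ : 0 < τ.im) : Differentiable ℂ (oddTheta τ) :=
  (differentiable_theta 1 0 hτ).comp (differentiable_id.sub_const (1 / 2))

theorem deriv_oddTheta_neg (τ z : ℂ) : deriv (oddTheta τ) (-z) = deriv (oddTheta τ) z := by
  have h := deriv_comp_neg (oddTheta τ) z
  simp only [oddTheta_neg, deriv.fun_neg] at h
  linear_combination h

theorem deriv_oddTheta_one_sub (τ z : ℂ) :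
    deriv (oddTheta τ) (1 - z) = -deriv (oddTheta τ) z := by
  have h := deriv_comp_const_sub (f := oddTheta τ) 1 z
  simp only [oddTheta_one_sub] at h
  exact neg_eq_iff_eq_neg.1 h.symm

/-- The three-term relation differentiated in `w` at `w = z`. -/
theorem oddTheta_three_term_deriv (x y z : ℂ) {τ : ℂ} (hτ : 0 < τ.im) :
    oddTheta τ (y + z) * oddTheta τ (y - z) *
        (deriv (oddTheta τ) (x + z) * oddTheta τ (x - z) -
          oddTheta τ (x + z) * deriv (oddTheta τ) (x - z)) +
      oddTheta τ (z + x) * oddTheta τ (z - x) *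
        (deriv (oddTheta τ) (y + z) * oddTheta τ (y - z) -
          oddTheta τ (y + z) * deriv (oddTheta τ) (y - z)) =
    deriv (oddTheta τ) 0 * oddTheta τ (2 * z) * (oddTheta τ (x + y) * oddTheta τ (x - y)) := by
  have hd (u : ℂ) : HasDerivAt (oddTheta τ) (deriv (oddTheta τ) u) u :=
    (differentiable_oddTheta hτ u).hasDerivAt
  have hm (u : ℂ) : HasDerivAt (fun w => oddTheta τ (u + w) * oddTheta τ (u - w))
      (deriv (oddTheta τ) (u + z) * oddTheta τ (u - z) +
        oddTheta τ (u + z) * -deriv (oddTheta τ) (u - z)) z :=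
    ((hd (u + z)).comp_const_add u z).mul ((hd (u - z)).comp_const_sub u z)
  have h := (((hm z).const_mul (oddTheta τ (x + y) * oddTheta τ (x - y))).add
    ((hm x).const_mul (oddTheta τ (y + z) * oddTheta τ (y - z)))).add
    ((hm y).const_mul (oddTheta τ (z + x) * oddTheta τ (z - x)))
  have h0 := h.unique ((hasDerivAt_const z (0 : ℂ)).congr_of_eventuallyEq
    (.of_forall fun w => oddTheta_three_term x y z w hτ))
  rw [sub_self, oddTheta_zero, ← two_mul] at h0
  linear_combination h0

/-- The three-term relation differentiated twice in `z` at `z = 0`. -/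
theorem oddTheta_three_term_deriv_two (x y : ℂ) {τ : ℂ} (hτ : 0 < τ.im) :
    (oddTheta τ x * deriv (deriv (oddTheta τ)) x - deriv (oddTheta τ) x ^ 2) * oddTheta τ y ^ 2 -
      (oddTheta τ y * deriv (deriv (oddTheta τ)) y - deriv (oddTheta τ) y ^ 2) *
        oddTheta τ x ^ 2 =
    deriv (oddTheta τ) 0 ^ 2 * (oddTheta τ (x + y) * oddTheta τ (x - y)) := by
  have hd (u : ℂ) : HasDerivAt (oddTheta τ) (deriv (oddTheta τ) u) u :=
    (differentiable_oddTheta hτ u).hasDerivAt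
  have hd2 (u : ℂ) : HasDerivAt (deriv (oddTheta τ)) (deriv (deriv (oddTheta τ)) u) u :=
    ((differentiable_oddTheta hτ).deriv u).hasDerivAt
  have hm (u h : ℂ) : HasDerivAt (fun w => oddTheta τ (u + w) * oddTheta τ (u - w))
      (deriv (oddTheta τ) (u + h) * oddTheta τ (u - h) +
        oddTheta τ (u + h) * -deriv (oddTheta τ) (u - h)) h :=
    ((hd (u + h)).comp_const_add u h).mul ((hd (u - h)).comp_const_sub u h)
  have hm2 (u : ℂ) : HasDerivAt (fun h => deriv (oddTheta τ) (u + h) * oddTheta τ (u - h) +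
        oddTheta τ (u + h) * -deriv (oddTheta τ) (u - h))
      (2 * (oddTheta τ u * deriv (deriv (oddTheta τ)) u - deriv (oddTheta τ) u ^ 2)) 0 := by
    have h1 := ((hd2 (u + 0)).comp_const_add u 0).mul ((hd (u - 0)).comp_const_sub u 0)
    have h2 := ((hd (u + 0)).comp_const_add u 0).mul ((hd2 (u - 0)).comp_const_sub u 0).neg
    refine (h1.add h2).congr_deriv ?_
    simp only [add_zero, sub_zero, Pi.neg_apply]
    ring
  -- At third variable 0 the relation reads σ(x+w)σ(x-w)σ(y)² - σ(y+w)σ(y-w)σ(x)² =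
  -- σ(w)²σ(x+y)σ(x-y); this is its derivative at w = h, differentiated again at 0 below.
  have key (h : ℂ) := (((hm x h).mul_const (oddTheta τ y ^ 2)).sub
    ((hm y h).mul_const (oddTheta τ x ^ 2))).unique
    ((((hd h).pow 2).const_mul (oddTheta τ (x + y) * oddTheta τ (x - y))).congr_of_eventuallyEq
      (.of_forall fun w => by
        have h3 := oddTheta_three_term x y 0 w hτ
        simp only [zero_add, zero_sub, add_zero, sub_zero, oddTheta_neg] at h3
        simp only [Pi.sub_apply, Pi.pow_apply]
        linear_combination h3))
  have h2 := (((hm2 x).mul_const (oddTheta τ y ^ 2)).sub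
    ((hm2 y).mul_const (oddTheta τ x ^ 2))).unique
    (((((hd 0).mul (hd2 0)).const_mul
      (2 * (oddTheta τ (x + y) * oddTheta τ (x - y))))).congr_of_eventuallyEq
      (.of_forall fun w => by
        have h3 := key w
        simp only [Pi.sub_apply, Pi.mul_apply]
        linear_combination h3))
  rw [oddTheta_zero] at h2
  linear_combination h2 / 2

/-! ### Theta constants and elimination -/

theorem theta_one_char_eq_oddTheta (ε' : ℝ) (ζ τ : ℂ) :
    theta 1 ε' ζ τ = oddTheta τ (1 / 2 - ε' / 2 - ζ) := by
  rw [theta_char_right, theta_one_eq_oddTheta]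
  congr 1
  ring

theorem thetaConst_one (ε' : ℝ) (τ : ℂ) : thetaConst 1 ε' τ = oddTheta τ (1 / 2 - ε' / 2) := by
  rw [thetaConst, theta_one_char_eq_oddTheta, sub_zero]

theorem thetaConst'_one (ε' : ℝ) (τ : ℂ) :
    thetaConst' 1 ε' τ = -deriv (oddTheta τ) (1 / 2 - ε' / 2) := by
  simp only [thetaConst', theta_one_char_eq_oddTheta]
  rw [deriv_comp_const_sub, sub_zero]

theorem thetaConst''_one (ε' : ℝ) (τ : ℂ) :
    thetaConst'' 1 ε' τ = deriv (deriv (oddTheta τ)) (1 / 2 - ε' / 2) := by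
  simp only [thetaConst'', theta_one_char_eq_oddTheta, iteratedDeriv_succ, iteratedDeriv_zero]
  have h : deriv (fun ζ => oddTheta τ (1 / 2 - ε' / 2 - ζ)) =
      fun ζ => -deriv (oddTheta τ) (1 / 2 - ε' / 2 - ζ) :=
    funext fun ζ => deriv_comp_const_sub ..
  rw [h, deriv.fun_neg, deriv_comp_const_sub, sub_zero, neg_neg]

/-- Elimination of the first derivatives `u`, `v` from the relations between the values and
derivatives of the odd theta function at `3 / 8` and `1 / 8`. -/
theorem div_sub_div_eq_of_relations {a b s t p u v c d : ℂ} (ha : a ≠ 0) (hb : b ≠ 0)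
    (h1 : s ^ 2 * (a ^ 2 - b ^ 2) = a * b * t ^ 2)
    (h2 : s ^ 3 * t = a * b * (a ^ 2 + b ^ 2))
    (h3 : p * s ^ 3 + 3 * a ^ 2 * b * u - a ^ 3 * v = 0)
    (h4 : p * s ^ 3 - 3 * a * b ^ 2 * v + b ^ 3 * u = 0)
    (h5 : (a * c - u ^ 2) * b ^ 2 - (b * d - v ^ 2) * a ^ 2 = p ^ 2 * (t * s)) :
    c / a - d / b = -(1 / 8 : ℂ) * (p ^ 2 * t * s / (a ^ 4 * b ^ 4)) *
      (a ^ 4 - 6 * a ^ 2 * b ^ 2 + b ^ 4) := by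
  have hu : 8 * a ^ 2 * b ^ 3 * u = p * s ^ 3 * (a ^ 2 - 3 * b ^ 2) := by
    linear_combination 3 * b ^ 2 * h3 - a ^ 2 * h4
  have hv : 8 * a ^ 3 * b ^ 2 * v = p * s ^ 3 * (3 * a ^ 2 - b ^ 2) := by
    linear_combination b ^ 2 * h3 - 3 * a ^ 2 * h4
  have hs : s ^ 6 * (a ^ 2 - b ^ 2) = s * t * (a * b) ^ 2 * (a ^ 2 + b ^ 2) := by
    linear_combination s ^ 4 * h1 + s * t * a * b * h2
  have huv : 8 * a ^ 4 * b ^ 4 * (u ^ 2 * b ^ 2 - v ^ 2 * a ^ 2) =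
      -(p ^ 2 * s * t * (a * b) ^ 2 * (a ^ 2 + b ^ 2) ^ 2) := by
    linear_combination (8 * a ^ 2 * b ^ 3 * u + p * s ^ 3 * (a ^ 2 - 3 * b ^ 2)) / 8 * hu -
      (8 * a ^ 3 * b ^ 2 * v + p * s ^ 3 * (3 * a ^ 2 - b ^ 2)) / 8 * hv -
      p ^ 2 * (a ^ 2 + b ^ 2) * hs
  -- The quartic arises as (a² + b²)² - 8a²b².
  have hab : 8 * a ^ 4 * b ^ 4 * ((c * b - d * a) * (a * b)) =
      -(p ^ 2 * t * s) * (a ^ 4 - 6 * a ^ 2 * b ^ 2 + b ^ 4) * (a * b) ^ 2 := by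
    linear_combination 8 * a ^ 4 * b ^ 4 * h5 + huv
  field_simp
  refine mul_left_cancel₀ (pow_ne_zero 2 (mul_ne_zero ha hb)) ?_
  linear_combination hab

end ThetaChar

theorem mainTheorem12 (τ : ℂ) (hτ : 0 < τ.im) :
    ThetaChar.thetaConst 1 (1 / 4) τ ≠ 0 ∧ ThetaChar.thetaConst 1 (3 / 4) τ ≠ 0 ∧
    ThetaChar.thetaConst'' 1 (1 / 4) τ / ThetaChar.thetaConst 1 (1 / 4) τ
        - ThetaChar.thetaConst'' 1 (3 / 4) τ / ThetaChar.thetaConst 1 (3 / 4) τ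
      = -(1 / 8 : ℂ)
        * ((ThetaChar.thetaConst' 1 1 τ) ^ 2
            * ThetaChar.thetaConst 1 0 τ * ThetaChar.thetaConst 1 (1 / 2) τ
          / ((ThetaChar.thetaConst 1 (1 / 4) τ) ^ 4 * (ThetaChar.thetaConst 1 (3 / 4) τ) ^ 4))
        * ((ThetaChar.thetaConst 1 (1 / 4) τ) ^ 4
            - 6 * (ThetaChar.thetaConst 1 (1 / 4) τ) ^ 2 * (ThetaChar.thetaConst 1 (3 / 4) τ) ^ 2
            + (ThetaChar.thetaConst 1 (3 / 4) τ) ^ 4) := by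
  open ThetaChar in
  have hne := theta_one_eighth_mul_ne_zero hτ
  rw [theta_one_eq_oddTheta, theta_one_eq_oddTheta, show (1 / 2 - 3 / 8 : ℂ) = 1 / 8 by norm_num,
    show (1 / 2 - 1 / 8 : ℂ) = 3 / 8 by norm_num] at hne
  have hb := left_ne_zero_of_mul hne
  have ha := right_ne_zero_of_mul hne
  have e1 : (1 / 2 - ((1 / 4 : ℝ) : ℂ) / 2 : ℂ) = 3 / 8 := by push_cast; norm_num
  have e2 : (1 / 2 - ((3 / 4 : ℝ) : ℂ) / 2 : ℂ) = 1 / 8 := by push_cast; norm_num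
  have e3 : (1 / 2 - ((1 / 2 : ℝ) : ℂ) / 2 : ℂ) = 1 / 4 := by push_cast; norm_num
  have e4 : (1 / 2 - ((0 : ℝ) : ℂ) / 2 : ℂ) = 1 / 2 := by push_cast; norm_num
  have e5 : (1 / 2 - ((1 : ℝ) : ℂ) / 2 : ℂ) = 0 := by push_cast; norm_num
  simp only [thetaConst_one, thetaConst'_one, thetaConst''_one, e1, e2, e3, e4, e5, neg_sq]
  have r5 := oddTheta_one_sub τ (3 / 8)
  have r6 := oddTheta_one_sub τ (1 / 4)
  have r9 : oddTheta τ (9 / 8) = -oddTheta τ (1 / 8) := by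
    rw [← oddTheta_neg, ← oddTheta_one_sub]; norm_num
  have d9 : deriv (oddTheta τ) (9 / 8) = -deriv (oddTheta τ) (1 / 8) := by
    rw [← deriv_oddTheta_neg τ (1 / 8), ← deriv_oddTheta_one_sub]; norm_num
  have n1 := oddTheta_neg τ (1 / 8)
  have n2 := oddTheta_neg τ (1 / 4)
  have n3 := oddTheta_neg τ (3 / 8)
  have n6 := oddTheta_neg τ (3 / 4)
  have dn1 := deriv_oddTheta_neg τ (1 / 8)
  have dn3 := deriv_oddTheta_neg τ (3 / 8)
  -- These points are chosen so that oddness and z ↦ 1 - z reduce every argument to 0, 1/8, 1/4, 3/8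
  -- or 1/2.
  have w1 := oddTheta_three_term (1 / 2) (1 / 4) (1 / 8) 0 hτ
  have w2 := oddTheta_three_term (3 / 8) (1 / 4) (1 / 8) 0 hτ
  have w3 := oddTheta_three_term_deriv 0 (3 / 4) (3 / 8) hτ
  have w4 := oddTheta_three_term_deriv 0 (1 / 4) (1 / 8) hτ
  have w5 := oddTheta_three_term_deriv_two (3 / 8) (1 / 8) hτ
  norm_num at r5 r6 r9 d9 n1 n2 n3 n6 dn1 dn3 w1 w2 w3 w4 w5 ha hb ⊢
  simp only [r5, r6, r9, d9, n1, n2, n3, n6, dn1, dn3] at w1 w2 w3 w4 w5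
  refine ⟨ha, hb, ?_⟩
  rw [div_sub_div_eq_of_relations ha hb (s := oddTheta τ (1 / 4)) (t := oddTheta τ (1 / 2))
    (p := deriv (oddTheta τ) 0) (u := deriv (oddTheta τ) (3 / 8))
    (v := deriv (oddTheta τ) (1 / 8)) (c := deriv (deriv (oddTheta τ)) (3 / 8))
    (d := deriv (deriv (oddTheta τ)) (1 / 8)) (by linear_combination -w1)
    (by linear_combination -w2) (by linear_combination w3) (by linear_combination w4)
    (by linear_combination w5)]
  ring
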